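/- Let $\overline{\mathbb{Q}}$ be an algebraic closure of $\mathbb{Q}$ and let $h:\overline{\mathbb{Q}}\to\mathbb{R}_{\ge 0}$ be the absolute logarithmic Weil height. For $\gamma\in\mathbb{R}$ and $a\in\overline{\mathbb{Q}}$ put $h_\gamma(a):=[\mathbb{Q}(a):\mathbb{Q}]^{\gamma}\,h(a)$. A set $A\subseteq\overline{\mathbb{Q}}$ is said to have the $\gamma$-Northcott property, $\gamma$-(N), if for every $C>0$ only finitely many $a\in A$ satisfy $h_\gamma(a)<C$, and $I_N(A)$ denotes the set of all $\gamma\in\mathbb{R}$ such that $A$ has $\gamma$-(N). Proposition 5.4. Let $(d_i)_{i\ge 1}$, $(p_i)_{i\ge 1}$ and $(q_i)_{i\ge 1}$ be strictly increasing sequences of prime numbers such that $$\exp\bigl(d_i^{\,1+i^2}\bigr)\le p_i<q_i<p_{i+1}\qquad\text{for all } i\ge 1.$$ For each $i\ge 1$ let $(p_i/q_i)^{1/d_i}\in\overline{\mathbb{Q}}$ be any fixed $d_i$-th root of $p_i/q_i$. Then the field $L:=\mathbb{Q}\bigl((p_i/q_i)^{1/d_i}\mid i\ge 1\bigr)$ is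 an infinite extension of $\mathbb{Q}$ and has $\gamma$-(N) for every $\gamma\in\mathbb{R}$, i.e. $I_N(L)=\mathbb{R}$. -/

import Mathlib

open scoped IntermediateField

noncomputable section

/-- The degree `[ℚ(a) : ℚ]` of an algebraic number `a`. -/
def algDeg (a : AlgebraicClosure ℚ) : ℕ :=
  Module.finrank ℚ ℚ⟮a⟯

/-- The `γ`-weighted Weil height `h_γ(a) = deg(a)^γ * h(a)`, where `h` is the absolute
logarithmic Weil height. -/
def weightedHeight (γ : ℝ) (a : AlgebraicClosure ℚ) : ℝ :=
  (algDeg a : ℝ) ^ γ * NumberField.absLogHeight₁ a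

/-- The number `N_γ(A, C)` (possibly infinite) of elements `a` of `A` with `h_γ(a) < C`. -/
def northcottCount (γ : ℝ) (A : Set (AlgebraicClosure ℚ)) (C : ℝ) : ℕ∞ :=
  {a ∈ A | weightedHeight γ a < C}.encard

/-- The `γ`-Northcott property, `γ`-(N). -/
def HasNorthcott (γ : ℝ) (A : Set (AlgebraicClosure ℚ)) : Prop :=
  ∀ C : ℝ, 0 < C → northcottCount γ A C < ⊤

/-- The set `I_N(A)` of all real `γ` for which `A` has the `γ`-Northcott property. -/
def northcottInterval (A : Set (AlgebraicClosure ℚ)) : Set ℝ :=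
  {γ : ℝ | HasNorthcott γ A}

end

/-! ### Frobenius on rings generated by roots of integers -/

/-! Let K_n be the field generated by the first n radicals, and write p, q, d, α for the data of
index n + 1, so that α^d = p/q. The primes p and q exceed all earlier d_j, p_j, q_j, so they are
unramified in K_n; above them K_n(α) is totally ramified of index d over K_n.

Let a lie in K_{n+1} but not in K_n, and choose σ fixing K_n and moving a. At places above p or q
the ramification makes σ(a) - a small: its d-th power gains a factor |p| or |q| over the trivial
estimate (`IsNonarchimedean.apply_sub_pow_le`). The product formula for σ(a) - a turns this into
log(pq) ≤ d(log 2 + 2h(a)) (`NumberField.pow_le_mulHeight₁_of_radical`,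
`absLogHeight₁_ge_of_radical`).

The growth of p then forces 2h(a) ≥ d^((n+1)^2), whereas deg(a) ≤ d^(n+1). A quadratic exponent
beats γ times a linear one, so h_γ(a) < C confines a to some K_n independent of a, a number field,
where Northcott's theorem applies. The extension is infinite because α_i has degree d_i. -/

lemma Nat.Prime.exists_dvd_pow_sub_self_of_adjoin_eq_top {R : Type*} [CommRing R] {p e : ℕ}
    (hp : p.Prime) (he : p.Coprime e) {S : Set R} (hS : Algebra.adjoin ℤ S = ⊤)
    (hroot : ∀ b ∈ S, ∃ u : ℤ, ¬ (p : ℤ) ∣ u ∧ b ^ e = u) :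
    ∃ n, 2 ≤ n ∧ ∀ x : R, (p : R) ∣ x ^ n - x := by
  have hcop : p.Coprime (e * (p - 1)) := by
    refine he.mul_right ?_
    rw [hp.coprime_iff_not_dvd]
    exact Nat.not_dvd_of_pos_of_lt (Nat.sub_pos_of_lt hp.one_lt) (Nat.sub_lt hp.pos one_pos)
  have he0 : 0 < e * (p - 1) := by
    refine Nat.mul_pos (Nat.pos_of_ne_zero ?_) (Nat.sub_pos_of_lt hp.one_lt)
    rintro rfl
    exact hp.one_lt.ne' (by simpa using he)
  -- By Euler e(p - 1) divides p^r - 1, so b^(p^r) is b times a power of u^(p-1), which is 1 mod p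
  -- by Fermat. The congruence x^(p^r) ≡ x passes to sums because p-power maps are additive mod p.
  set r := Nat.totient (e * (p - 1)) with hr
  have hr0 : r ≠ 0 := (Nat.totient_pos.mpr he0).ne'
  have h1 : 1 < p ^ r := Nat.one_lt_pow hr0 hp.one_lt
  obtain ⟨m, hm⟩ : e * (p - 1) ∣ p ^ r - 1 :=
    (Nat.modEq_iff_dvd' h1.le).mp (Nat.ModEq.pow_totient hcop).symm
  refine ⟨p ^ r, h1, fun x ↦ ?_⟩
  have hx : x ∈ Algebra.adjoin ℤ S := hS ▸ Algebra.mem_top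
  induction hx using Algebra.adjoin_induction with
  | mem b hb =>
    obtain ⟨u, hu, hbu⟩ := hroot b hb
    have hfermat : (p : ℤ) ∣ u ^ ((p - 1) * m) - 1 := by
      have : Fact p.Prime := ⟨hp⟩
      rw [← ZMod.intCast_eq_intCast_iff_dvd_sub]
      have hu' : (u : ZMod p) ≠ 0 := by rwa [Ne, ZMod.intCast_zmod_eq_zero_iff_dvd]
      push_cast
      rw [pow_mul, ZMod.pow_card_sub_one_eq_one hu', one_pow]
    have hb' : b ^ p ^ r - b = b * ((u ^ ((p - 1) * m) - 1 : ℤ) : R) := by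
      have : p ^ r = e * ((p - 1) * m) + 1 := by rw [← mul_assoc, ← hm]; omega
      rw [this, pow_succ, pow_mul, hbu]
      push_cast
      ring
    rw [hb']
    refine Dvd.dvd.mul_left ?_ b
    obtain ⟨k, hk⟩ := hfermat
    exact ⟨k, by rw [hk]; push_cast; rfl⟩
  | algebraMap z =>
    have : Fact p.Prime := ⟨hp⟩
    have hz : (p : ℤ) ∣ z ^ p ^ r - z := by
      rw [← ZMod.intCast_eq_intCast_iff_dvd_sub]
      push_cast
      rw [ZMod.pow_card_pow]
    obtain ⟨k, hk⟩ := hz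
    refine ⟨k, ?_⟩
    have := congrArg (Int.cast : ℤ → R) hk
    push_cast at this
    simpa using this
  | add x y _ _ hx hy =>
    obtain ⟨t, ht⟩ := exists_add_pow_prime_pow_eq hp x y r
    have : (x + y) ^ p ^ r - (x + y) = (x ^ p ^ r - x) + (y ^ p ^ r - y) + p * (x * y * t) := by
      rw [ht]; ring
    rw [this]
    exact (hx.add hy).add (Dvd.intro _ rfl)
  | mul x y _ _ hx hy =>
    have : (x * y) ^ p ^ r - x * y = x ^ p ^ r * (y ^ p ^ r - y) + y * (x ^ p ^ r - x) := by
      rw [mul_pow]; ring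
    rw [this]
    exact (hy.mul_left _).add (hx.mul_left _)

/-! ### Nonarchimedean absolute values -/

section AbsoluteValue

variable {M : Type*} [Field M] [CharZero M] {v : AbsoluteValue M ℝ} {p : ℕ}

omit [CharZero M] in
lemma IsNonarchimedean.apply_sub_le (hv : IsNonarchimedean v) (x y : M) :
    v (x - y) ≤ max (v x) (v y) := by
  simpa [sub_eq_add_neg] using hv x (-y)

/-- If v x < 1, then x^(n-1) - 1 has value 1, so x^n - x = p y gives v x = v p * v y with y again in
`B`. This descent must stop, since v x > 0 is not below every power of v p. Thus p is a uniformizer,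
i.e. v is unramified. -/
lemma IsNonarchimedean.exists_apply_eq_pow_of_frobenius (hv : IsNonarchimedean v)
    (hp : p ≠ 0) (hvp : v p < 1) {B : Subalgebra ℤ M} (hB : ∀ x ∈ B, v x ≤ 1) {n : ℕ} (hn : 2 ≤ n)
    (hfrob : ∀ x ∈ B, ∃ y ∈ B, x ^ n - x = p * y) {x : M} (hx : x ∈ B) (hx0 : x ≠ 0) :
    ∃ k : ℕ, v x = v p ^ k := by
  have hp0 : 0 < v p := v.pos (Nat.cast_ne_zero.mpr hp)
  have key : ∀ m : ℕ, ∀ x ∈ B, x ≠ 0 → (∃ k : ℕ, v x = v p ^ k) ∨ v x ≤ v p ^ m := by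
    intro m
    induction m with
    | zero => exact fun x hx _ ↦ .inr (by simpa using hB x hx)
    | succ m ih =>
      intro x hx hx0
      rcases (hB x hx).eq_or_lt with h1 | h1
      · exact .inl ⟨0, by simpa using h1⟩
      obtain ⟨y, hy, hxy⟩ := hfrob x hx
      have hunit : v (x ^ (n - 1) - 1) = 1 := by
        have hlt : v (x ^ (n - 1)) < v (-1) := by
          simpa using pow_lt_one₀ (v.nonneg x) h1 (by omega)
        simpa [sub_eq_add_neg] using hv.add_eq_right_of_lt hlt
      have hxv : v x = v p * v y := by
        have h2 : x * (x ^ (n - 1) - 1) = p * y := by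
          rw [← hxy, mul_sub, ← pow_succ', mul_one]
          congr 2
          omega
        rw [← v.map_mul, ← h2, v.map_mul, hunit, mul_one]
      have hy0 : y ≠ 0 := by
        rintro rfl
        exact hx0 (by simpa using hxv)
      rcases ih y hy hy0 with ⟨k, hk⟩ | hle
      · exact .inl ⟨k + 1, by rw [hxv, hk, pow_succ']⟩
      · refine .inr ?_
        rw [hxv, pow_succ']
        gcongr
  obtain ⟨m, hm⟩ := exists_pow_lt_of_lt_one (v.pos hx0) hvp
  exact (key m x hx hx0).resolve_right hm.not_ge

lemma IsNonarchimedean.exists_apply_eq_pow_of_mem_adjoin_int (hv : IsNonarchimedean v)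
    (hp : p.Prime) (hvp : v p < 1) {e : ℕ} (he : p.Coprime e) {x : M}
    (hx : x ∈ Algebra.adjoin ℤ {b : M | ∃ u : ℤ, ¬ (p : ℤ) ∣ u ∧ b ^ e = u}) (hx0 : x ≠ 0) :
    ∃ k : ℕ, v x = v p ^ k := by
  have he0 : e ≠ 0 := by
    rintro rfl
    exact hp.one_lt.ne' (by simpa using he)
  set T := {b : M | ∃ u : ℤ, ¬ (p : ℤ) ∣ u ∧ b ^ e = u}
  have hB : ∀ x ∈ Algebra.adjoin ℤ T, v x ≤ 1 := by
    intro x hx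
    induction hx using Algebra.adjoin_induction with
    | mem b hb =>
      obtain ⟨u, -, hu⟩ := hb
      have : v b ^ e ≤ 1 := by
        rw [← map_pow, hu]
        exact hv.apply_intCast_le_one
      exact (pow_le_one_iff_of_nonneg (v.nonneg b) he0).mp this
    | algebraMap z => simpa using hv.apply_intCast_le_one
    | add x y _ _ hx hy => exact (hv x y).trans (max_le hx hy)
    | mul x y _ _ hx hy => simpa using mul_le_one₀ hx (v.nonneg y) hy
  obtain ⟨n, hn, hfrob⟩ := hp.exists_dvd_pow_sub_self_of_adjoin_eq_top he
    (R := Algebra.adjoin ℤ T) (Algebra.adjoin_adjoin_coe_preimage (R := ℤ) (s := T))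
    (fun b ⟨u, hu, hbu⟩ ↦ ⟨u, hu, Subtype.ext (by simpa using hbu)⟩)
  refine hv.exists_apply_eq_pow_of_frobenius hp.ne_zero hvp hB hn (fun x hx ↦ ?_) hx hx0
  obtain ⟨y, hy⟩ := hfrob ⟨x, hx⟩
  exact ⟨y, y.2, by simpa using congrArg Subtype.val hy⟩

/-- An absolute value above `p` is unramified on the field generated by `e`-th roots of rational
numbers which are `p`-adic units, when `p` is prime to `e`. -/
lemma IsNonarchimedean.exists_apply_eq_zpow_of_mem_adjoin [Algebra.IsAlgebraic ℚ M]
    (hv : IsNonarchimedean v)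
    (hp : p.Prime) (hvp : v p < 1) {e : ℕ} (he : p.Coprime e) {S : Set M}
    (hS : ∀ a ∈ S, ∃ w u : ℤ, w ≠ 0 ∧ ¬ (p : ℤ) ∣ u ∧ (w * a) ^ e = u) {c : M}
    (hc : c ∈ IntermediateField.adjoin ℚ S) (hc0 : c ≠ 0) :
    ∃ k : ℤ, v c = v p ^ k := by
  set B := Algebra.adjoin ℤ {b : M | ∃ u : ℤ, ¬ (p : ℤ) ∣ u ∧ b ^ e = u}
  -- By algebraicity ℚ(S) = ℚ[S], so a nonzero integer n moves c into `B`; v c is then the quotient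
  -- of the two powers of v p given by n * c and n.
  have hden : ∃ n : ℤ, n ≠ 0 ∧ n * c ∈ B := by
    rw [← IntermediateField.mem_toSubalgebra,
      IntermediateField.adjoin_toSubalgebra_of_isAlgebraic (fun x _ ↦ Algebra.IsAlgebraic.isAlgebraic x)] at hc
    clear hc0
    induction hc using Algebra.adjoin_induction with
    | mem a ha =>
      obtain ⟨w, u, hw, hu, hwu⟩ := hS a ha
      exact ⟨w, hw, Algebra.subset_adjoin ⟨u, hu, hwu⟩⟩
    | algebraMap q =>
      refine ⟨q.den, by exact_mod_cast q.den_nz, ?_⟩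
      have : ((q.den : ℤ) : M) * algebraMap ℚ M q = (q.num : M) := by
        rw [eq_ratCast, Int.cast_natCast]
        exact_mod_cast congrArg (Rat.cast : ℚ → M) (Rat.den_mul_eq_num q)
      rw [this]
      exact intCast_mem B _
    | add x y _ _ hx hy =>
      obtain ⟨m, hm, hmx⟩ := hx
      obtain ⟨n, hn, hny⟩ := hy
      refine ⟨m * n, mul_ne_zero hm hn, ?_⟩
      have : ((m * n : ℤ) : M) * (x + y) = n * (m * x) + m * (n * y) := by push_cast; ring
      rw [this]
      exact add_mem (mul_mem (intCast_mem B _) hmx) (mul_mem (intCast_mem B _) hny)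
    | mul x y _ _ hx hy =>
      obtain ⟨m, hm, hmx⟩ := hx
      obtain ⟨n, hn, hny⟩ := hy
      refine ⟨m * n, mul_ne_zero hm hn, ?_⟩
      have : ((m * n : ℤ) : M) * (x * y) = (m * x) * (n * y) := by push_cast; ring
      rw [this]
      exact mul_mem hmx hny
  obtain ⟨n, hn, hnc⟩ := hden
  have hn' : (n : M) ≠ 0 := Int.cast_ne_zero.mpr hn
  obtain ⟨k, hk⟩ := hv.exists_apply_eq_pow_of_mem_adjoin_int hp hvp he hnc (mul_ne_zero hn' hc0)
  obtain ⟨l, hl⟩ := hv.exists_apply_eq_pow_of_mem_adjoin_int hp hvp he (intCast_mem B n) hn'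
  have hp0 : v p ≠ 0 := v.ne_zero (Nat.cast_ne_zero.mpr hp.ne_zero)
  refine ⟨k - l, ?_⟩
  rw [v.map_mul, hl] at hk
  rw [zpow_sub₀ hp0, zpow_natCast, zpow_natCast, ← hk]
  field_simp

/-- For a totally and tamely ramified radical extension, `σ x - x` lies in the maximal ideal. -/
lemma IsNonarchimedean.apply_sub_le_of_sum {v : AbsoluteValue M ℝ} (hv : IsNonarchimedean v)
    {K : Set M} {π α : M} {d : ℕ} (hπ0 : π ≠ 0) (hπ : v π < 1)
    (hK : ∀ c ∈ K, c ≠ 0 → ∃ k : ℤ, v c = v π ^ k) (hα : v α ^ d = v π)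
    (σ : M →+* M) (hσK : ∀ c ∈ K, σ c = c) (hσα : v (σ α) = v α)
    {c : ℕ → M} (hc : ∀ j, c j ∈ K) {x : M} (hx : x = ∑ j ∈ Finset.range d, c j * α ^ j)
    (hx1 : v x ≤ 1) : v (σ x - x) ≤ v α := by
  have hπ0' : 0 < v π := v.pos hπ0
  have hd : d ≠ 0 := by
    rintro rfl
    exact hπ.ne (by simpa using hα.symm)
  have hθ0 : 0 < v α := by
    refine lt_of_le_of_ne (v.nonneg α) fun h ↦ hπ0'.ne ?_
    rw [← hα, ← h, zero_pow hd]
  have hθ1 : v α < 1 := by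
    refine (pow_lt_one_iff_of_nonneg (v.nonneg α) hd).mp ?_
    rwa [hα]
  have hterm : ∀ j, c j ≠ 0 → ∃ k : ℤ, v (c j * α ^ j) = v α ^ (d * k + j) := by
    intro j hj
    obtain ⟨k, hk⟩ := hK _ (hc j) hj
    refine ⟨k, ?_⟩
    rw [v.map_mul, hk, ← hα, map_pow, zpow_add₀ hθ0.ne', zpow_mul, zpow_natCast, zpow_natCast]
  -- Nonzero terms have values v(α)^(dk+j) with distinct residues j mod d, hence distinct values. A
  -- largest term exceeding 1 would therefore be the value of the whole sum.
  have hbound : ∀ j ∈ Finset.range d, v (c j * α ^ j) ≤ 1 := by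
    by_contra! hcon
    obtain ⟨i, hi, hi1⟩ := hcon
    obtain ⟨m, hm, hmax⟩ := Finset.exists_max_image (Finset.range d) (fun j ↦ v (c j * α ^ j)) ⟨i, hi⟩
    have hm1 : 1 < v (c m * α ^ m) := hi1.trans_le (hmax i hi)
    have hcm : c m ≠ 0 := by
      rintro h
      rw [h, zero_mul, map_zero] at hm1
      linarith
    have hlt : ∀ j ∈ Finset.range d, j ≠ m → v (c j * α ^ j) < v (c m * α ^ m) := by
      intro j hj hjm
      refine lt_of_le_of_ne (hmax j hj) fun heq ↦ hjm ?_
      have hcj : c j ≠ 0 := by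
        rintro h
        rw [h, zero_mul, map_zero] at heq
        linarith
      obtain ⟨k, hk⟩ := hterm j hcj
      obtain ⟨l, hl⟩ := hterm m hcm
      rw [hk, hl] at heq
      have hexp := zpow_right_injective₀ hθ0 hθ1.ne heq
      have hmod : (j : ℤ) % d = (m : ℤ) % d := by
        have := congrArg (· % (d : ℤ)) hexp
        simpa [Int.add_emod] using this
      rw [Finset.mem_range] at hj hm
      rw [Int.emod_eq_of_lt (by positivity) (by exact_mod_cast hj),
        Int.emod_eq_of_lt (by positivity) (by exact_mod_cast hm)] at hmod
      exact_mod_cast hmod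
    have := hv.apply_sum_eq_of_lt (fun a ↦ (map_neg_eq_map v a).symm) hm hlt
    rw [← hx] at this
    linarith
  have hdiff : σ x - x = ∑ j ∈ Finset.range d, (c j * (σ α) ^ j - c j * α ^ j) := by
    rw [hx, map_sum, ← Finset.sum_sub_distrib]
    refine Finset.sum_congr rfl fun j _ ↦ ?_
    rw [map_mul, map_pow, hσK _ (hc j)]
  rw [hdiff]
  obtain ⟨j, hj, hle⟩ := hv.finset_image_add_of_nonempty
    (fun j ↦ c j * (σ α) ^ j - c j * α ^ j) (Finset.nonempty_range_iff.mpr hd)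
  refine hle.trans ?_
  rcases eq_or_ne (c j) 0 with h0 | h0
  · simp [h0]
  rcases Nat.eq_zero_or_pos j with rfl | hj0
  · simp
  have hle' : v (c j * (σ α) ^ j - c j * α ^ j) ≤ v (c j * α ^ j) := by
    refine (hv.apply_sub_le _ _).trans (le_of_eq ?_)
    simp [hσα]
  refine hle'.trans ?_
  have h1 := hbound j hj
  obtain ⟨k, hk⟩ := hterm j h0
  rw [hk] at h1 ⊢
  have hexp : 0 ≤ (d : ℤ) * k + j := by
    by_contra! hneg
    exact (one_lt_zpow_of_neg₀ hθ0 hθ1 hneg).not_ge h1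
  -- The exponent is congruent to j mod d with 0 < j < d, so it cannot vanish. The term j = 0 is
  -- fixed by σ and was settled above.
  have hexp' : 1 ≤ (d : ℤ) * k + j := by
    refine (Int.add_one_le_iff.mpr (lt_of_le_of_ne hexp fun h ↦ ?_))
    rw [Finset.mem_range] at hj
    have hdvd : (d : ℤ) ∣ j := ⟨-k, by linarith⟩
    have := Nat.le_of_dvd hj0 (by exact_mod_cast hdvd)
    omega
  calc v α ^ ((d : ℤ) * k + j) ≤ v α ^ (1 : ℤ) := zpow_le_zpow_right_of_le_one₀ hθ0 hθ1.le hexp'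
    _ = v α := zpow_one _

end AbsoluteValue

/-! ### Heights and extensions of number fields -/

namespace NumberField

open Height Module

variable {F M : Type*} [Field F] [Field M] [NumberField F] [NumberField M]

lemma prod_infinitePlace_pow_mult (f : InfinitePlace F → ℝ) :
    ∏ v, f v ^ v.mult = ∏ φ : F →+* ℂ, f (.mk φ) := by
  classical
  rw [← Finset.prod_fiberwise Finset.univ InfinitePlace.mk (fun φ : F →+* ℂ ↦ f (.mk φ))]
  refine Finset.prod_congr rfl fun w _ ↦ ?_
  have h : ∀ φ ∈ ({φ | InfinitePlace.mk φ = w} : Finset (F →+* ℂ)), f (.mk φ) = f w := by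
    intro φ hφ
    rw [(Finset.mem_filter.mp hφ).2]
  rw [Finset.prod_congr rfl h, Finset.prod_const, InfinitePlace.card_filter_mk_eq]

variable [Algebra F M]

/-- Each embedding of F into ℂ has exactly [M : F] extensions to M. -/
lemma prod_embeddings_comp_algebraMap (f : (F →+* ℂ) → ℝ) :
    ∏ φ : M →+* ℂ, f (φ.comp (algebraMap F M)) = (∏ ψ, f ψ) ^ finrank F M := by
  classical
  rw [← Finset.prod_fiberwise Finset.univ (fun φ : M →+* ℂ ↦ φ.comp (algebraMap F M)),
    ← Finset.prod_pow]
  refine Finset.prod_congr rfl fun ψ _ ↦ ?_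
  have h : ∀ φ ∈ ({φ | φ.comp (algebraMap F M) = ψ} : Finset (M →+* ℂ)),
      f (φ.comp (algebraMap F M)) = f ψ := by
    intro φ hφ
    rw [(Finset.mem_filter.mp hφ).2]
  rw [Finset.prod_congr rfl h, Finset.prod_const]
  congr 1
  let : Algebra F ℂ := ψ.toAlgebra
  rw [← AlgHom.card F M ℂ, ← Finset.card_univ]
  symm
  refine Finset.card_bij (fun σ _ ↦ σ.toRingHom) (fun σ _ ↦ ?_) (fun σ _ τ _ h ↦ ?_) fun φ hφ ↦ ?_
  · exact Finset.mem_filter.mpr ⟨Finset.mem_univ _, σ.comp_algebraMap⟩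
  · exact AlgHom.coe_ringHom_injective h
  · exact ⟨{ φ with commutes' := RingHom.congr_fun (Finset.mem_filter.mp hφ).2 },
      Finset.mem_univ _, rfl⟩

lemma prod_infinitePlace_algebraMap {ι : Type*} (x : ι → F) :
    ∏ v : InfinitePlace M, (⨆ i, v (algebraMap F M (x i))) ^ v.mult =
      (∏ v : InfinitePlace F, (⨆ i, v (x i)) ^ v.mult) ^ finrank F M := by
  rw [prod_infinitePlace_pow_mult (fun v : InfinitePlace M ↦ ⨆ i, v (algebraMap F M (x i))),
    prod_infinitePlace_pow_mult (fun v : InfinitePlace F ↦ ⨆ i, v (x i)),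
    ← prod_embeddings_comp_algebraMap]
  rfl

/-- For integral coordinates the product is the inverse of the absolute norm of the ideal they
generate, and extending an ideal to M raises its norm to the power [M : F]. This avoids a count of
the places above each place of F. -/
lemma finprod_finitePlace_algebraMap {ι : Type*} [Finite ι] {x : ι → 𝓞 F} (hx : x ≠ 0) :
    ∏ᶠ v : FinitePlace M, ⨆ i, v (algebraMap F M (x i)) =
      (∏ᶠ v : FinitePlace F, ⨆ i, v (x i)) ^ finrank F M := by
  have hx' : (fun i ↦ algebraMap (𝓞 F) (𝓞 M) (x i)) ≠ 0 := by
    obtain ⟨i, hi⟩ := Function.ne_iff.mp hx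
    refine Function.ne_iff.mpr ⟨i, ?_⟩
    simpa using hi
  have h1 := absNorm_mul_finprod_finitePlace_eq_one hx
  have h2 := absNorm_mul_finprod_finitePlace_eq_one hx'
  have hspan : Ideal.span (Set.range fun i ↦ algebraMap (𝓞 F) (𝓞 M) (x i)) =
      (Ideal.span (Set.range x)).map (algebraMap (𝓞 F) (𝓞 M)) := by
    rw [Ideal.map_span, ← Set.range_comp]
    rfl
  have hrank : finrank (𝓞 F) (𝓞 M) = finrank F M :=
    (IsFractionRing.finrank_eq (𝓞 F) F (𝓞 M) M).symm
  rw [hspan, Ideal.absNorm_algebraMap, hrank] at h2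
  push_cast at h2
  have h3 : ((Ideal.span (Set.range x)).absNorm : ℝ) ≠ 0 := left_ne_zero_of_mul_eq_one h1
  refine mul_left_cancel₀ (pow_ne_zero (finrank F M) h3) ?_
  rw [← mul_pow, h1, one_pow]
  exact h2

/-- Compatibility of the relative height with extensions of number fields. -/
theorem mulHeight₁_algebraMap (x : F) :
    mulHeight₁ (algebraMap F M x) = mulHeight₁ x ^ finrank F M := by
  obtain ⟨a, b, hb, rfl⟩ := IsFractionRing.div_surjective (A := 𝓞 F) x
  have hb0 : b ≠ 0 := nonZeroDivisors.ne_zero hb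
  have hx : ![a, b] ≠ 0 := by simp [hb0]
  have hx1 : (fun i ↦ algebraMap (𝓞 F) F (![a, b] i)) ≠ 0 :=
    Function.ne_iff.mpr ⟨1, by simpa using hb0⟩
  have hx2 : (fun i ↦ algebraMap F M (algebraMap (𝓞 F) F (![a, b] i))) ≠ 0 :=
    Function.ne_iff.mpr ⟨1, by simpa using hb0⟩
  have e1 : ![algebraMap (𝓞 F) F a, algebraMap (𝓞 F) F b] =
      fun i ↦ algebraMap (𝓞 F) F (![a, b] i) := by
    ext i; fin_cases i <;> rfl
  have e2 : ![algebraMap F M (algebraMap (𝓞 F) F a), algebraMap F M (algebraMap (𝓞 F) F b)] =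
      fun i ↦ algebraMap F M (algebraMap (𝓞 F) F (![a, b] i)) := by
    ext i; fin_cases i <;> rfl
  rw [map_div₀, mulHeight₁_div_eq_mulHeight, mulHeight₁_div_eq_mulHeight, e1, e2,
    mulHeight_eq hx1, mulHeight_eq hx2, mul_pow, prod_infinitePlace_algebraMap,
    finprod_finitePlace_algebraMap hx]

omit [Algebra F M] in
theorem mulHeight₁_ringHom_pow (f : F →+* M) (x : F) :
    mulHeight₁ (f x) ^ finrank ℚ F = mulHeight₁ x ^ finrank ℚ M := by
  let : Algebra F M := f.toAlgebra
  have : IsScalarTower ℚ F M := .of_algebraMap_eq fun q ↦ by simp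
  rw [← finrank_mul_finrank ℚ F M, mul_comm, pow_mul]
  congr 1
  exact mulHeight₁_algebraMap x

theorem mulHeight₁_ringEnd (f : F →+* F) (x : F) : mulHeight₁ (f x) = mulHeight₁ x :=
  (pow_left_inj₀ (mulHeight₁_nonneg _) (mulHeight₁_nonneg _) finrank_pos.ne').mp
    (mulHeight₁_ringHom_pow f x)

end NumberField

open NumberField in
/-- The absolute height can be computed in any number field. -/
theorem NumberField.absLogHeight₁_eq {M : Type*} [Field M] [NumberField M] {E : Type*} [Field E]
    [CharZero E] (f : M →+* E) (x : M) :
    absLogHeight₁ (f x) = Height.logHeight₁ x / Module.finrank ℚ M := by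
  classical
  let g : M →ₐ[ℚ] E := f.toRatAlgHom
  have hx : IsIntegral ℚ (f x) := (IsIntegral.of_finite ℚ x).map g
  have : FiniteDimensional ℚ ℚ⟮f x⟯ := IntermediateField.adjoin.finiteDimensional hx
  have : NumberField ℚ⟮f x⟯ := {}
  have hmem : ℚ⟮f x⟯ ≤ g.fieldRange := by
    rw [IntermediateField.adjoin_simple_le_iff]
    exact ⟨x, rfl⟩
  let i : ℚ⟮f x⟯ →+* M := 
    (g.equivFieldRange.symm.toAlgHom.comp (IntermediateField.inclusion hmem)).toRingHom
  have hi : i (IntermediateField.AdjoinSimple.gen ℚ (f x)) = x := by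
    apply f.injective
    have h : g (g.equivFieldRange.symm (IntermediateField.inclusion hmem
        (IntermediateField.AdjoinSimple.gen ℚ (f x)))) = f x := by
      have := congrArg Subtype.val (g.equivFieldRange.apply_symm_apply (IntermediateField.inclusion hmem
        (IntermediateField.AdjoinSimple.gen ℚ (f x))))
      exact this
    exact h
  have key := mulHeight₁_ringHom_pow i (IntermediateField.AdjoinSimple.gen ℚ (f x))
  rw [hi] at key
  have hlog := congrArg Real.log key
  rw [Real.log_pow, Real.log_pow] at hlog
  have h1 : (Module.finrank ℚ M : ℝ) ≠ 0 := Nat.cast_ne_zero.mpr Module.finrank_pos.ne'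
  have h2 : (Module.finrank ℚ ℚ⟮f x⟯ : ℝ) ≠ 0 := Nat.cast_ne_zero.mpr Module.finrank_pos.ne'
  rw [absLogHeight₁, absMulHeight₁, dif_pos hx, Real.log_rpow (Height.mulHeight₁_pos _),
    Height.logHeight₁]
  field_simp
  linarith

-- Division with remainder by the monic polynomial X^d - α^d. Its irreducibility is not needed, as
-- the expansion need not be unique.
open IntermediateField in
lemma IntermediateField.exists_sum_pow_of_mem_adjoin_insert {F M : Type*} [Field F] [Field M]
    [Algebra F M] {S : Set M} {α x : M} {d : ℕ} (hd : d ≠ 0) (hα : α ^ d ∈ adjoin F S)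
    (hx : x ∈ adjoin F (insert α S)) :
    ∃ c : ℕ → M, (∀ j, c j ∈ adjoin F S) ∧ x = ∑ j ∈ Finset.range d, c j * α ^ j := by
  set K := adjoin F S
  have hmonic := Polynomial.monic_X_pow_sub_C (⟨α ^ d, hα⟩ : K) hd
  have hroot : Polynomial.aeval α (Polynomial.X ^ d - Polynomial.C (⟨α ^ d, hα⟩ : K)) = 0 := by
    simp [IntermediateField.algebraMap_apply]
  have hint : IsIntegral K α := ⟨_, hmonic, hroot⟩
  have hx' : x ∈ K⟮α⟯ := by
    rw [Set.insert_eq, Set.union_comm, ← adjoin_adjoin_left] at hx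
    exact hx
  rw [← mem_toSubalgebra, adjoin_simple_toSubalgebra_of_isAlgebraic hint.isAlgebraic,
    Algebra.adjoin_singleton_eq_range_aeval] at hx'
  obtain ⟨f, rfl⟩ := hx'
  refine ⟨fun j ↦ ((f %ₘ (Polynomial.X ^ d - Polynomial.C (⟨α ^ d, hα⟩ : K))).coeff j : K),
    fun j ↦ SetLike.coe_mem _, ?_⟩
  have hdeg : (f %ₘ (Polynomial.X ^ d - Polynomial.C (⟨α ^ d, hα⟩ : K))).natDegree < d := by
    refine (Polynomial.natDegree_modByMonic_lt f hmonic ?_).trans_eq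
      (Polynomial.natDegree_X_pow_sub_C)
    intro h
    have := congrArg Polynomial.natDegree h
    rw [Polynomial.natDegree_X_pow_sub_C, Polynomial.natDegree_one] at this
    exact hd this
  have hmod : Polynomial.aeval α f =
      Polynomial.aeval α (f %ₘ (Polynomial.X ^ d - Polynomial.C (⟨α ^ d, hα⟩ : K))) :=
    (Polynomial.aeval_modByMonic_eq_self_of_root hroot).symm
  change Polynomial.aeval α f = _
  rw [hmod, Polynomial.aeval_eq_sum_range' hdeg]
  rfl

/-! ### Local bounds for σ(x) - x -/

section LocalBound

variable {M : Type*} [Field M] {v : AbsoluteValue M ℝ}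

/-- When v x > 1 the integral case applies to x⁻¹, through σ(x) - x = -(σ(x⁻¹) - x⁻¹) x σ(x). Since
σ need not preserve v, both v x and v (σ x) enter. -/
lemma IsNonarchimedean.apply_sub_le_mul_max_of_forall_le_one {σ : M →+* M} {θ : ℝ} (hθ : 0 ≤ θ)
    {x : M} (h : v x ≤ 1 → v (σ x - x) ≤ θ) (hinv : v x⁻¹ ≤ 1 → v (σ x⁻¹ - x⁻¹) ≤ θ) :
    v (σ x - x) ≤ θ * (max (v x) 1 * max (v (σ x)) 1) := by
  rcases le_or_gt (v x) 1 with h1 | h1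
  · refine (h h1).trans (le_mul_of_one_le_right hθ ?_)
    exact one_le_mul_of_one_le_of_one_le (le_max_right _ _) (le_max_right _ _)
  · have hx0 : x ≠ 0 := by
      rintro rfl
      rw [map_zero] at h1
      linarith
    have hσx0 : σ x ≠ 0 := (map_ne_zero σ).mpr hx0
    have h2 := hinv (by rw [map_inv₀]; exact inv_le_one_of_one_le₀ h1.le)
    have h3 : σ x - x = -(σ x⁻¹ - x⁻¹) * (x * σ x) := by
      rw [map_inv₀]
      field_simp
      ring
    rw [h3, map_mul, map_mul, map_neg_eq_map]
    gcongr
    · exact le_max_left _ _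
    · exact le_max_left _ _

/-- `S` consists of `e`-th roots of `p`-adic units (up to integer factors). -/
def IsUnitRoots (p e : ℕ) (S : Set M) : Prop :=
  ∀ a ∈ S, ∃ w u : ℤ, w ≠ 0 ∧ ¬ (p : ℤ) ∣ u ∧ (w * a) ^ e = u

variable [CharZero M] [Algebra.IsAlgebraic ℚ M]

lemma IsNonarchimedean.apply_sub_pow_le_of_ramified (hv : IsNonarchimedean v)
    {p e d : ℕ} (hp : p.Prime) (hvp : v p < 1) (he : p.Coprime e) {S : Set M}
    (hS : IsUnitRoots p e S) {α : M} (hαK : α ^ d ∈ IntermediateField.adjoin ℚ S)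
    (hα : v α ^ d = v p) (σ : M →+* M) (hσ : ∀ c ∈ IntermediateField.adjoin ℚ S, σ c = c)
    {x : M} (hx : x ∈ IntermediateField.adjoin ℚ (insert α S)) :
    v (σ x - x) ^ d ≤ v p * (max (v x) 1 * max (v (σ x)) 1) ^ d := by
  have hd : d ≠ 0 := by
    rintro rfl
    exact hvp.ne (by simpa using hα.symm)
  have hσα : v (σ α) = v α := by
    refine (pow_left_inj₀ (v.nonneg _) (v.nonneg _) hd).mp ?_
    rw [← map_pow, ← map_pow, ← map_pow, hσ _ hαK]
  have main : ∀ y ∈ IntermediateField.adjoin ℚ (insert α S), v y ≤ 1 → v (σ y - y) ≤ v α := by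
    intro y hy hy1
    obtain ⟨c, hc, hyc⟩ := IntermediateField.exists_sum_pow_of_mem_adjoin_insert hd hαK hy
    exact hv.apply_sub_le_of_sum (K := IntermediateField.adjoin ℚ S)
      (Nat.cast_ne_zero.mpr hp.ne_zero) hvp
      (fun c hc hc0 ↦ hv.exists_apply_eq_zpow_of_mem_adjoin hp hvp he hS hc hc0) hα σ hσ hσα hc
      hyc hy1
  rw [← hα, ← mul_pow]
  exact pow_le_pow_left₀ (v.nonneg _) (IsNonarchimedean.apply_sub_le_mul_max_of_forall_le_one
    (v.nonneg α) (main x hx) (main _ (inv_mem hx))) d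

/-- By Bézout at most one of v p, v q is below 1. Above p the ramified bound is used with α, above q
with α⁻¹, and elsewhere the ultrametric inequality suffices. The factor v (p * q) covers all three
cases uniformly. -/
lemma IsNonarchimedean.apply_sub_pow_le (hv : IsNonarchimedean v)
    {p q e d : ℕ} (hp : p.Prime) (hq : q.Prime) (hpq : p ≠ q) (hpe : p.Coprime e)
    (hqe : q.Coprime e) {S : Set M} (hSp : IsUnitRoots p e S) (hSq : IsUnitRoots q e S) {α : M}
    (hα : α ^ d = p / q) (σ : M →+* M) (hσ : ∀ c ∈ IntermediateField.adjoin ℚ S, σ c = c)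
    {x : M} (hx : x ∈ IntermediateField.adjoin ℚ (insert α S)) :
    v (σ x - x) ^ d ≤ v (p * q) * (max (v x) 1 * max (v (σ x)) 1) ^ d := by
  have hle (n : ℕ) : v n ≤ 1 := by simpa using hv.apply_intCast_le_one (n := (n : ℤ))
  have hαK : α ^ d ∈ IntermediateField.adjoin ℚ S := by
    rw [hα]
    exact div_mem (natCast_mem _ p) (natCast_mem _ q)
  have hmax : v p = 1 ∨ v q = 1 := by
    by_contra! h
    have hp1 := (hle p).lt_of_ne h.1
    have hq1 := (hle q).lt_of_ne h.2
    have hbez := congrArg (Int.cast : ℤ → M) (Nat.gcd_eq_gcd_ab p q)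
    rw [(Nat.coprime_primes hp hq).mpr hpq] at hbez
    push_cast at hbez
    have h1 : v ((p : M) * (p.gcdA q : ℤ) + q * (p.gcdB q : ℤ)) < 1 := by
      refine (hv _ _).trans_lt (max_lt ?_ ?_) <;> rw [map_mul]
      · exact mul_lt_one_of_nonneg_of_lt_one_left (v.nonneg _) hp1 hv.apply_intCast_le_one
      · exact mul_lt_one_of_nonneg_of_lt_one_left (v.nonneg _) hq1 hv.apply_intCast_le_one
    rw [← hbez, map_one] at h1
    exact h1.false
  rcases (hle p).lt_or_eq with hp1 | hp1
  · have hq1 : v q = 1 := hmax.resolve_left hp1.ne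
    rw [map_mul, hq1, mul_one]
    refine hv.apply_sub_pow_le_of_ramified hp hp1 hpe hSp hαK ?_ σ hσ hx
    rw [← map_pow, hα, map_div₀, hq1, div_one]
  rcases (hle q).lt_or_eq with hq1 | hq1
  · rw [map_mul, hp1, one_mul]
    have hαK' : α⁻¹ ^ d ∈ IntermediateField.adjoin ℚ S := by
      rw [inv_pow]
      exact inv_mem hαK
    refine hv.apply_sub_pow_le_of_ramified hq hq1 hqe hSq hαK' ?_ σ hσ ?_
    · rw [← map_pow, inv_pow, hα, inv_div, map_div₀, hp1, div_one]
    · refine IntermediateField.adjoin_le_iff.mpr ?_ hx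
      rintro y (rfl | hy)
      · have := inv_mem (IntermediateField.subset_adjoin ℚ (insert y⁻¹ S) (Set.mem_insert _ _))
        rwa [inv_inv] at this
      · exact IntermediateField.subset_adjoin _ _ (Set.mem_insert_of_mem _ hy)
  · rw [map_mul, hp1, hq1, one_mul, one_mul]
    refine pow_le_pow_left₀ (v.nonneg _) ((hv.apply_sub_le _ _).trans (max_le ?_ ?_)) d
    · exact (le_max_left _ 1).trans (le_mul_of_one_le_left (by positivity) (le_max_right _ _))
    · exact (le_max_left _ 1).trans (le_mul_of_one_le_right (by positivity) (le_max_right _ _))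

end LocalBound

/-! ### Lower bound for the height of generators -/

open NumberField Height Module

lemma NumberField.prod_infinitePlace_sub_le {M : Type*} [Field M] [NumberField M] (x y : M) :
    ∏ v : InfinitePlace M, v (x - y) ^ v.mult ≤ 2 ^ finrank ℚ M *
      ((∏ v : InfinitePlace M, max (v x) 1 ^ v.mult) *
        ∏ v : InfinitePlace M, max (v y) 1 ^ v.mult) := by
  rw [← InfinitePlace.sum_mult_eq, ← Finset.prod_pow_eq_pow_sum, ← Finset.prod_mul_distrib,
    ← Finset.prod_mul_distrib]
  refine Finset.prod_le_prod (fun v _ ↦ by positivity) fun v _ ↦ ?_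
  rw [← mul_pow, ← mul_pow]
  refine pow_le_pow_left₀ (by positivity) ?_ _
  have h : v (x - y) ≤ v x + v y := by
    simpa [sub_eq_add_neg] using! v.1.add_le x (-y)
  have h1 : v x ≤ max (v x) 1 * max (v y) 1 :=
    (le_max_left _ 1).trans (le_mul_of_one_le_right (by positivity) (le_max_right _ _))
  have h2 : v y ≤ max (v x) 1 * max (v y) 1 :=
    (le_max_left _ 1).trans (le_mul_of_one_le_left (by positivity) (le_max_right _ _))
  linarith

lemma NumberField.hasFiniteMulSupport_max_finitePlace {M : Type*} [Field M] [NumberField M]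
    (x : M) : (fun v : FinitePlace M ↦ max (v x) 1).HasFiniteMulSupport := by
  rcases eq_or_ne x 0 with rfl | hx
  · simp [Function.HasFiniteMulSupport]
  · exact (FinitePlace.hasFiniteMulSupport hx).subset fun v hv h ↦ hv (by simp_all)

/-- Lower bound for the height of an element of `K(α)` outside `K`, where `α ^ d = p / q` and
`p`, `q` are unramified in `K = ℚ(S)`. -/
theorem NumberField.pow_le_mulHeight₁_of_radical {M : Type*} [Field M] [NumberField M]
    [IsGalois ℚ M] {p q e d : ℕ} (hp : p.Prime) (hq : q.Prime) (hpq : p ≠ q) (hpe : p.Coprime e)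
    (hqe : q.Coprime e) {S : Set M} (hSp : IsUnitRoots p e S) (hSq : IsUnitRoots q e S) {α : M}
    (hα : α ^ d = p / q) {x : M} (hx : x ∈ IntermediateField.adjoin ℚ (insert α S))
    (hxS : x ∉ IntermediateField.adjoin ℚ S) :
    ((p * q : ℕ) : ℝ) ^ finrank ℚ M ≤ (2 ^ finrank ℚ M * mulHeight₁ x ^ 2) ^ d := by
  set K := IntermediateField.adjoin ℚ S
  obtain ⟨σ, hσ⟩ : ∃ σ : M ≃ₐ[K] M, σ x ≠ x := by
    by_contra! h
    have := (IsGalois.mem_bot_iff_fixed (F := K) x).mpr h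
    rw [IntermediateField.mem_bot] at this
    obtain ⟨y, rfl⟩ := this
    exact hxS y.2
  let τ : M →+* M := σ.toRingEquiv.toRingHom
  have hτ : ∀ c ∈ K, τ c = c := fun c hc ↦ σ.commutes ⟨c, hc⟩
  have hδ : τ x - x ≠ 0 := sub_ne_zero.mpr hσ
  have hpq0 : (p * q : M) ≠ 0 :=
    mul_ne_zero (Nat.cast_ne_zero.mpr hp.ne_zero) (Nat.cast_ne_zero.mpr hq.ne_zero)
  have hx_fin := hasFiniteMulSupport_max_finitePlace x
  have hτx_fin := hasFiniteMulSupport_max_finitePlace (τ x)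
  have hmax_fin : (fun v : FinitePlace M ↦ max (v x) 1 * max (v (τ x)) 1).HasFiniteMulSupport :=
    hx_fin.mul hτx_fin
  have hmax_pow_fin :
      (fun v : FinitePlace M ↦ (max (v x) 1 * max (v (τ x)) 1) ^ d).HasFiniteMulSupport :=
    hmax_fin.pow d
  have hloc : ∏ᶠ v : FinitePlace M, v (τ x - x) ^ d ≤
      ∏ᶠ v : FinitePlace M, v (p * q : M) * (max (v x) 1 * max (v (τ x)) 1) ^ d := by
    refine finprod_le_finprod ?_ (fun v ↦ by positivity) ?_ fun v ↦ ?_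
    · exact (FinitePlace.hasFiniteMulSupport hδ).pow d
    · exact (FinitePlace.hasFiniteMulSupport hpq0).mul hmax_pow_fin
    · exact IsNonarchimedean.apply_sub_pow_le (v := v.1) (FinitePlace.add_le v) hp hq hpq hpe hqe
        hSp hSq hα τ hτ hx
  rw [finprod_mul_distrib (FinitePlace.hasFiniteMulSupport hpq0) hmax_pow_fin,
    ← finprod_pow hmax_fin, finprod_mul_distrib hx_fin hτx_fin,
    ← finprod_pow (FinitePlace.hasFiniteMulSupport hδ)] at hloc
  have hinf := prod_infinitePlace_sub_le (τ x) x
  -- The product formula gives A * B = 1, and makes the finite part C of pq the inverse of its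
  -- infinite part (pq)^[M : ℚ].
  have hprod := prod_abs_eq_one hδ
  have hprod_pq := prod_abs_eq_one hpq0
  have hinf_pq : ∏ v : InfinitePlace M, v (p * q : M) ^ v.mult = ((p * q : ℕ) : ℝ) ^ finrank ℚ M := by
    rw [← InfinitePlace.sum_mult_eq, ← Finset.prod_pow_eq_pow_sum]
    refine Finset.prod_congr rfl fun v _ ↦ ?_
    have : v ((p * q : ℕ) : M) = ((p * q : ℕ) : ℝ) := by
      rw [← InfinitePlace.norm_embedding_eq, map_natCast, Complex.norm_natCast]
    rw [← this]
    push_cast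
    rfl
  rw [hinf_pq] at hprod_pq
  have hH := NumberField.mulHeight₁_eq x
  have hHτ := NumberField.mulHeight₁_eq (τ x)
  rw [mulHeight₁_ringEnd] at hHτ
  set A := ∏ v : InfinitePlace M, v (τ x - x) ^ v.mult
  set B := ∏ᶠ v : FinitePlace M, v (τ x - x)
  set C := ∏ᶠ v : FinitePlace M, v (p * q : M)
  set I₁ := ∏ v : InfinitePlace M, max (v x) 1 ^ v.mult
  set I₂ := ∏ v : InfinitePlace M, max (v (τ x)) 1 ^ v.mult
  set J₁ := ∏ᶠ v : FinitePlace M, max (v x) 1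
  set J₂ := ∏ᶠ v : FinitePlace M, max (v (τ x)) 1
  have hA : 0 ≤ A := Finset.prod_nonneg fun v _ ↦ by positivity
  have hB : 0 ≤ B := finprod_nonneg fun v ↦ by positivity
  have hJ : 0 ≤ J₁ * J₂ :=
    mul_nonneg (finprod_nonneg fun v ↦ by positivity) (finprod_nonneg fun v ↦ by positivity)
  calc ((p * q : ℕ) : ℝ) ^ finrank ℚ M = ((p * q : ℕ) : ℝ) ^ finrank ℚ M * (A ^ d * B ^ d) := by
        rw [← mul_pow, hprod, one_pow, mul_one]
    _ ≤ ((p * q : ℕ) : ℝ) ^ finrank ℚ M *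
        ((2 ^ finrank ℚ M * (I₂ * I₁)) ^ d * (C * (J₁ * J₂) ^ d)) := by
        gcongr
    _ = (((p * q : ℕ) : ℝ) ^ finrank ℚ M * C) * (2 ^ finrank ℚ M * ((I₁ * J₁) * (I₂ * J₂))) ^ d := by
        ring
    _ = (2 ^ finrank ℚ M * mulHeight₁ x ^ 2) ^ d := by
        rw [hprod_pq, ← hH, ← hHτ, one_mul, sq]

/-! ### Absolute heights and degrees in the algebraic closure -/

open IntermediateField

instance AlgebraicClosure.isAlgebraic_rat : Algebra.IsAlgebraic ℚ (AlgebraicClosure ℚ) := by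
  convert! AlgebraicClosure.isAlgebraic ℚ

instance AlgebraicClosure.isAlgClosure_rat : IsAlgClosure ℚ (AlgebraicClosure ℚ) :=
  ⟨inferInstance, inferInstance⟩

/-- The bound is applied in the normal closure M of ℚ(S, α). After taking logarithms both sides
carry the factor [M : ℚ], so the result does not depend on M. -/
lemma absLogHeight₁_ge_of_radical {p q e d : ℕ} (hp : p.Prime) (hq : q.Prime) (hpq : p ≠ q)
    (hpe : p.Coprime e) (hqe : q.Coprime e) {S : Set (AlgebraicClosure ℚ)} (hfin : S.Finite)
    (hSp : IsUnitRoots p e S) (hSq : IsUnitRoots q e S) {α : AlgebraicClosure ℚ}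
    (hα : α ^ d = p / q) {x : AlgebraicClosure ℚ} (hx : x ∈ adjoin ℚ (insert α S))
    (hxS : x ∉ adjoin ℚ S) :
    Real.log (p * q : ℕ) ≤ d * (Real.log 2 + 2 * absLogHeight₁ x) := by
  have : Finite (insert α S : Set (AlgebraicClosure ℚ)) := hfin.insert α
  have : FiniteDimensional ℚ (adjoin ℚ (insert α S)) :=
    finiteDimensional_adjoin fun y _ ↦ Algebra.IsIntegral.isIntegral y
  let M := normalClosure ℚ (adjoin ℚ (insert α S)) (AlgebraicClosure ℚ)
  have hle : adjoin ℚ (insert α S) ≤ M := le_normalClosure _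
  have hsub : insert α S ⊆ (M : Set (AlgebraicClosure ℚ)) :=
    (subset_adjoin ℚ (insert α S)).trans hle
  have : NumberField M := { to_finiteDimensional := normalClosure.is_finiteDimensional ℚ _ _ }
  have : Normal ℚ (AlgebraicClosure ℚ) := IsAlgClosure.normal ℚ _
  have : Normal ℚ M := normalClosure.normal ..
  have : IsGalois ℚ M := ⟨⟩
  have himage : M.val '' (M.val ⁻¹' S) = S := by
    rw [Set.image_preimage_eq_inter_range, Set.inter_eq_left]
    intro y hy
    exact ⟨⟨y, hsub (Set.mem_insert_of_mem _ hy)⟩, rfl⟩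
  let β : M := ⟨α, hsub (Set.mem_insert _ _)⟩
  let y : M := ⟨x, hle hx⟩
  have himage' : M.val '' (insert β (M.val ⁻¹' S)) = insert α S := by
    rw [Set.image_insert_eq, himage]
    rfl
  have hy : y ∈ adjoin ℚ (insert β (M.val ⁻¹' S)) := by
    rw [← himage', ← adjoin_map] at hx
    obtain ⟨z, hz, hzx⟩ := hx
    rwa [show y = z from Subtype.ext hzx.symm]
  have hyS : y ∉ adjoin ℚ (M.val ⁻¹' S) := by
    intro h
    refine hxS ?_
    rw [← himage, ← adjoin_map]
    exact ⟨y, h, rfl⟩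
  have hroots {ℓ : ℕ} (h : IsUnitRoots ℓ e S) : IsUnitRoots ℓ e (M.val ⁻¹' S) := by
    intro a ha
    obtain ⟨w, u, hw, hu, hwu⟩ := h _ ha
    exact ⟨w, u, hw, hu, Subtype.ext (by simpa using hwu)⟩
  have key := pow_le_mulHeight₁_of_radical hp hq hpq hpe hqe (hroots hSp) (hroots hSq)
    (α := β) (Subtype.ext (by simpa using hα)) hy hyS
  have hpos : (0 : ℝ) < (p * q : ℕ) := Nat.cast_pos.mpr (Nat.mul_pos hp.pos hq.pos)
  have hlog := Real.log_le_log (by positivity) key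
  have hH : mulHeight₁ y ≠ 0 := mulHeight₁_ne_zero y
  rw [Real.log_pow, Real.log_pow, Real.log_mul (by positivity) (by positivity), Real.log_pow,
    Real.log_pow] at hlog
  have hh : absLogHeight₁ x = _ := NumberField.absLogHeight₁_eq M.val.toRingHom y
  have hN : (0 : ℝ) < finrank ℚ M := Nat.cast_pos.mpr finrank_pos
  rw [hh, logHeight₁]
  refine le_of_mul_le_mul_left (hlog.trans_eq ?_) hN
  push_cast
  field_simp

lemma isUnitRoots_of_prime_gt {ι : Type*} {M : Type*} [Field M] [CharZero M] {d p q : ι → ℕ}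
    (hd : ∀ i, d i ≠ 0)
    (hp : ∀ i, p i ≠ 0) (hq : ∀ i, q i ≠ 0) {α : ι → M} (hα : ∀ i, α i ^ d i = p i / q i)
    {ℓ : ℕ} (hℓ : ℓ.Prime) {s : Set ι} (hps : ∀ i ∈ s, p i < ℓ) (hqs : ∀ i ∈ s, q i < ℓ)
    {e : ℕ} (he : ∀ i ∈ s, d i ∣ e) : IsUnitRoots ℓ e (α '' s) := by
  rintro _ ⟨i, hi, rfl⟩
  obtain ⟨m, rfl⟩ := he i hi
  -- Clearing the denominator, (q α)^d = q^(d-1) p, whose prime factors divide p or q and so are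
  -- smaller than ℓ.
  refine ⟨q i, ((q i ^ (d i - 1) * p i) ^ m : ℕ), by exact_mod_cast hq i, ?_, ?_⟩
  · rw [Int.natCast_dvd_natCast]
    intro h
    rcases hℓ.dvd_mul.mp (hℓ.dvd_of_dvd_pow h) with h | h
    · exact (Nat.le_of_dvd (Nat.pos_of_ne_zero (hq i)) (hℓ.dvd_of_dvd_pow h)).not_gt (hqs i hi)
    · exact (Nat.le_of_dvd (Nat.pos_of_ne_zero (hp i)) h).not_gt (hps i hi)
  · have hq0 : (q i : M) ≠ 0 := Nat.cast_ne_zero.mpr (hq i)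
    have : (q i : M) ^ d i = q i ^ (d i - 1) * q i := by
      rw [← pow_succ, Nat.sub_add_cancel (Nat.pos_of_ne_zero (hd i))]
    push_cast
    rw [pow_mul, mul_pow, hα, this]
    field_simp

lemma algDeg_le_finrank {E : IntermediateField ℚ (AlgebraicClosure ℚ)} [FiniteDimensional ℚ E]
    {a : AlgebraicClosure ℚ} (ha : a ∈ E) : algDeg a ≤ finrank ℚ E :=
  IntermediateField.finrank_le_of_le_right (adjoin_simple_le_iff.mpr ha)

lemma algDeg_pos (a : AlgebraicClosure ℚ) : 0 < algDeg a := by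
  have : FiniteDimensional ℚ ℚ⟮a⟯ := adjoin.finiteDimensional (Algebra.IsIntegral.isIntegral a)
  exact finrank_pos

lemma absLogHeight₁_nonneg (a : AlgebraicClosure ℚ) : 0 ≤ absLogHeight₁ a := by
  have : FiniteDimensional ℚ ℚ⟮a⟯ := adjoin.finiteDimensional (Algebra.IsIntegral.isIntegral a)
  have : NumberField ℚ⟮a⟯ := {}
  rw [show a = (ℚ⟮a⟯).val.toRingHom (AdjoinSimple.gen ℚ a) from rfl, NumberField.absLogHeight₁_eq]
  exact div_nonneg (zero_le_logHeight₁ _) (Nat.cast_nonneg _)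

lemma absLogHeight₁_le_pow_mul_weightedHeight {γ : ℝ} {g D : ℕ} (hg : -γ ≤ g)
    {a : AlgebraicClosure ℚ} (ha : algDeg a ≤ D) :
    absLogHeight₁ a ≤ (D : ℝ) ^ g * weightedHeight γ a := by
  have h1 : (1 : ℝ) ≤ algDeg a := by exact_mod_cast algDeg_pos a
  have h2 : 1 ≤ (D : ℝ) ^ g * (algDeg a : ℝ) ^ γ := by
    calc (1 : ℝ) ≤ (algDeg a : ℝ) ^ ((g : ℝ) + γ) := Real.one_le_rpow h1 (by linarith)
      _ = (algDeg a : ℝ) ^ g * (algDeg a : ℝ) ^ γ := by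
        rw [Real.rpow_add (by linarith), Real.rpow_natCast]
      _ ≤ (D : ℝ) ^ g * (algDeg a : ℝ) ^ γ := by gcongr
  rw [weightedHeight, ← mul_assoc]
  exact le_mul_of_one_le_left (absLogHeight₁_nonneg a) h2

/-- Degrees of elements of E are at most [E : ℚ], so a bound on h_γ bounds h, and Northcott's
theorem for the number field E applies. -/
lemma finite_weightedHeight_lt (γ C : ℝ) (E : IntermediateField ℚ (AlgebraicClosure ℚ))
    [FiniteDimensional ℚ E] : {a | a ∈ E ∧ weightedHeight γ a < C}.Finite := by
  have : NumberField E := {}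
  obtain ⟨g, hg⟩ := exists_nat_ge (-γ)
  refine ((finite_setOfPred_logHeight₁_le E
    ((finrank ℚ E : ℝ) ^ g * C * finrank ℚ E)).image E.val).subset ?_
  rintro a ⟨ha, hC⟩
  refine ⟨⟨a, ha⟩, ?_, rfl⟩
  have h1 := absLogHeight₁_le_pow_mul_weightedHeight hg (algDeg_le_finrank ha)
  have h2 : absLogHeight₁ a = _ := NumberField.absLogHeight₁_eq E.val.toRingHom ⟨a, ha⟩
  have hN : (0 : ℝ) < finrank ℚ E := Nat.cast_pos.mpr finrank_pos
  rw [h2, div_le_iff₀ hN] at h1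
  refine h1.trans ?_
  gcongr

lemma Rat.pow_ne_prime_div_prime {p q d : ℕ} (hp : p.Prime) (hq : q.Prime) (hpq : p ≠ q)
    (hd : 1 < d) (b : ℚ) : b ^ d ≠ p / q := by
  have : Fact p.Prime := ⟨hp⟩
  have : Fact q.Prime := ⟨hq⟩
  have hp0 : (p : ℚ) ≠ 0 := Nat.cast_ne_zero.mpr hp.ne_zero
  have hq0 : (q : ℚ) ≠ 0 := Nat.cast_ne_zero.mpr hq.ne_zero
  intro h
  have hval := congrArg (padicValRat p) h
  rw [padicValRat.div hp0 hq0, padicValRat.self hp.one_lt, padicValRat.of_nat,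
    padicValNat_primes hpq, padicValRat.pow] at hval
  have hdvd : (d : ℤ) ∣ 1 := ⟨padicValRat p b, by simpa using hval.symm⟩
  have := Int.le_of_dvd one_pos hdvd
  omega

lemma finrank_adjoin_radical {p q d : ℕ} (hp : p.Prime) (hq : q.Prime) (hpq : p ≠ q)
    (hd : d.Prime) {α : AlgebraicClosure ℚ} (hα : α ^ d = p / q) : finrank ℚ ℚ⟮α⟯ = d := by
  have hirr : Irreducible (Polynomial.X ^ d - Polynomial.C ((p : ℚ) / q)) :=
    X_pow_sub_C_irreducible_of_prime hd (Rat.pow_ne_prime_div_prime hp hq hpq hd.one_lt)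
  rw [adjoin.finrank (Algebra.IsIntegral.isIntegral α),
    ← minpoly.eq_of_irreducible_of_monic hirr (by simp [hα])
      (Polynomial.monic_X_pow_sub_C _ hd.ne_zero), Polynomial.natDegree_X_pow_sub_C]

/-- The field generated by the first `n` members of a sequence of algebraic numbers. -/
noncomputable def initialField (α : ℕ+ → AlgebraicClosure ℚ) (n : ℕ) :
    IntermediateField ℚ (AlgebraicClosure ℚ) :=
  adjoin ℚ (α '' {j | (j : ℕ) ≤ n})

lemma PNat.finite_setOf_coe_le (n : ℕ) : {j : ℕ+ | (j : ℕ) ≤ n}.Finite :=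
  (Set.finite_le_nat n).preimage PNat.coe_injective.injOn

lemma image_coe_le_succ {β : Type*} (α : ℕ+ → β) (n : ℕ) :
    α '' {j | (j : ℕ) ≤ n + 1} = insert (α n.succPNat) (α '' {j | (j : ℕ) ≤ n}) := by
  rw [← Set.image_insert_eq]
  congr 1
  ext j
  simp only [Set.mem_insert_iff, Set.mem_ofPred_eq, ← PNat.coe_inj, Nat.succPNat_coe]
  omega

lemma initialField_succ (α : ℕ+ → AlgebraicClosure ℚ) (n : ℕ) :
    initialField α (n + 1) = adjoin ℚ (insert (α n.succPNat) (α '' {j | (j : ℕ) ≤ n})) := by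
  rw [initialField, image_coe_le_succ]

instance (α : ℕ+ → AlgebraicClosure ℚ) (n : ℕ) : FiniteDimensional ℚ (initialField α n) :=
  have : Finite (α '' {j | (j : ℕ) ≤ n}) := (PNat.finite_setOf_coe_le n).image α
  finiteDimensional_adjoin fun y _ ↦ Algebra.IsIntegral.isIntegral y

lemma exists_mem_initialField {α : ℕ+ → AlgebraicClosure ℚ} {a : AlgebraicClosure ℚ}
    (ha : a ∈ adjoin ℚ (Set.range α)) : ∃ n, a ∈ initialField α n := by
  classical
  obtain ⟨T, hT, haT⟩ := exists_finset_of_mem_adjoin ha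
  have hsub : ∃ n : ℕ, (T : Set (AlgebraicClosure ℚ)) ⊆ α '' {j | (j : ℕ) ≤ n} := by
    clear haT
    induction T using Finset.induction_on with
    | empty => exact ⟨0, by simp⟩
    | insert b T _ ih =>
      rw [Finset.coe_insert, Set.insert_subset_iff] at hT
      obtain ⟨n, hn⟩ := ih hT.2
      obtain ⟨i, rfl⟩ := hT.1
      refine ⟨max n i, ?_⟩
      rw [Finset.coe_insert, Set.insert_subset_iff]
      refine ⟨⟨i, le_max_right n (i : ℕ), rfl⟩, hn.trans (Set.image_mono fun j hj ↦ ?_)⟩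
      exact le_trans hj (le_max_left n i)
  obtain ⟨n, hn⟩ := hsub
  exact ⟨n, adjoin.mono ℚ _ _ hn haT⟩

lemma finrank_initialField_succ_le {d : ℕ+ → ℕ} (hd : Monotone d)
    {α : ℕ+ → AlgebraicClosure ℚ} (hα : ∀ i, finrank ℚ ℚ⟮α i⟯ = d i) (n : ℕ) :
    finrank ℚ (initialField α (n + 1)) ≤ d n.succPNat ^ (n + 1) := by
  have hstep (m : ℕ) : finrank ℚ (initialField α (m + 1)) ≤
      d m.succPNat * finrank ℚ (initialField α m) := by
    rw [initialField_succ, Set.insert_eq, adjoin_union, ← hα]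
    exact finrank_sup_le ..
  induction n with
  | zero =>
    have h0 : initialField α 0 = ⊥ := by
      have : {j : ℕ+ | (j : ℕ) ≤ 0} = ∅ := by
        ext j
        simp
      rw [initialField, this, Set.image_empty, adjoin_empty]
    have := hstep 0
    rw [h0, IntermediateField.finrank_bot] at this
    simpa using this
  | succ n ih =>
    refine (hstep (n + 1)).trans ?_
    rw [pow_succ' _ (n + 1)]
    refine Nat.mul_le_mul_left _ (ih.trans (Nat.pow_le_pow_left (hd ?_) _))
    rw [← PNat.coe_le_coe]
    simp

theorem pow_le_two_mul_absLogHeight₁ {d p q : ℕ+ → ℕ} (hp : StrictMono p)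
    (hd_prime : ∀ i, (d i).Prime) (hp_prime : ∀ i, (p i).Prime) (hq_prime : ∀ i, (q i).Prime)
    (hdp : ∀ i : ℕ+, Real.exp ((d i : ℝ) ^ (1 + (i : ℕ) ^ 2)) ≤ (p i : ℝ))
    (hpq : ∀ i, p i < q i) (hqp : ∀ i, q i < p (i + 1))
    {α : ℕ+ → AlgebraicClosure ℚ} (hα : ∀ i, α i ^ d i = p i / q i) (n : ℕ)
    {a : AlgebraicClosure ℚ} (ha : a ∈ initialField α (n + 1)) (han : a ∉ initialField α n) :
    (d n.succPNat : ℝ) ^ ((n + 1) ^ 2) ≤ 2 * absLogHeight₁ a := by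
  set i := n.succPNat with hi
  have hdp' (j : ℕ+) : d j < p j := by
    have h1 : (1 : ℝ) ≤ d j := by exact_mod_cast (hd_prime j).one_le
    have h2 : (d j : ℝ) ≤ (d j : ℝ) ^ (1 + (j : ℕ) ^ 2) := le_self_pow₀ h1 (by omega)
    have h3 := Real.add_one_le_exp ((d j : ℝ) ^ (1 + (j : ℕ) ^ 2))
    exact_mod_cast (show (d j : ℝ) < p j by linarith [hdp j])
  have hlt {j : ℕ+} (hj : (j : ℕ) ≤ n) : q j < p i := by
    refine (hqp j).trans_le (hp.monotone ?_)
    rw [← PNat.coe_le_coe, hi, PNat.add_coe]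
    simpa using hj
  set s := (PNat.finite_setOf_coe_le n).toFinset
  -- The product of the earlier d_j serves as common exponent e; it is prime to p_i and q_i because
  -- d_j < p_j < q_j < p_i for j ≤ n.
  have hs (j : ℕ+) : j ∈ s ↔ (j : ℕ) ≤ n := by simp [s]
  have hcop {ℓ : ℕ} (hℓ : ℓ.Prime) (h : p i ≤ ℓ) : ℓ.Coprime (∏ j ∈ s, d j) := by
    refine Nat.Coprime.prod_right fun j hj ↦ ?_
    rw [hℓ.coprime_iff_not_dvd]
    refine Nat.not_dvd_of_pos_of_lt (hd_prime j).pos ?_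
    have := hlt ((hs j).mp hj)
    have := hdp' j
    have := hpq j
    omega
  have hroots {ℓ : ℕ} (hℓ : ℓ.Prime) (h : p i ≤ ℓ) :
      IsUnitRoots ℓ (∏ j ∈ s, d j) (α '' {j | (j : ℕ) ≤ n}) :=
    isUnitRoots_of_prime_gt (fun j ↦ (hd_prime j).ne_zero) (fun j ↦ (hp_prime j).ne_zero)
      (fun j ↦ (hq_prime j).ne_zero) hα hℓ (fun j hj ↦ ((hpq j).trans (hlt hj)).trans_le h)
      (fun j hj ↦ (hlt hj).trans_le h) fun j hj ↦ Finset.dvd_prod_of_mem d ((hs j).mpr hj)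
  have hle := (hpq i).le
  rw [initialField_succ] at ha
  have key := absLogHeight₁_ge_of_radical (hp_prime i) (hq_prime i) (hpq i).ne
    (hcop (hp_prime i) le_rfl) (hcop (hq_prime i) hle)
    ((PNat.finite_setOf_coe_le n).image α) (hroots (hp_prime i) le_rfl)
    (hroots (hq_prime i) hle) (hα i) ha han
  have hp0 : (0 : ℝ) < p i := Nat.cast_pos.mpr (hp_prime i).pos
  have hq0 : (0 : ℝ) < q i := Nat.cast_pos.mpr (hq_prime i).pos
  have hlogp : (d i : ℝ) ^ (1 + (i : ℕ) ^ 2) ≤ Real.log (p i) :=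
    (Real.le_log_iff_exp_le hp0).mpr (hdp i)
  have hlogq : Real.log (p i) ≤ Real.log (q i) := Real.log_le_log hp0 (Nat.cast_le.mpr hle)
  have hD : (1 : ℝ) ≤ d i := by exact_mod_cast (hd_prime i).one_le
  have hX : (1 : ℝ) ≤ (d i : ℝ) ^ ((n + 1) ^ 2) := one_le_pow₀ hD
  rw [hi, Nat.succPNat_coe, ← hi, Nat.succ_eq_add_one, pow_add, pow_one] at hlogp
  rw [Nat.cast_mul, Real.log_mul hp0.ne' hq0.ne'] at key
  -- The extra 1 in the exponent 1 + i^2 cancels the factor d_i of `key`, and q_i > p_i yields the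
  -- 2. One of the two copies of d_i^((n+1)^2) ≥ 1 then absorbs log 2.
  have h2 : 2 * (d i : ℝ) ^ ((n + 1) ^ 2) ≤ Real.log 2 + 2 * absLogHeight₁ a :=
    le_of_mul_le_mul_left (a := (d i : ℝ)) (by linarith) (by linarith)
  have := Real.log_two_lt_d9
  linarith

theorem le_weightedHeight_of_pow_le {γ : ℝ} {g n D : ℕ} (hg : -γ ≤ g) (hgn : g ≤ n) (hD : 2 ≤ D)
    {a : AlgebraicClosure ℚ} (hdeg : algDeg a ≤ D ^ (n + 1))
    (hh : (D : ℝ) ^ ((n + 1) ^ 2) ≤ 2 * absLogHeight₁ a) : (n : ℝ) ≤ weightedHeight γ a := by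
  have hD' : (2 : ℝ) ≤ D := by exact_mod_cast hD
  have h1 := absLogHeight₁_le_pow_mul_weightedHeight hg hdeg
  rw [Nat.cast_pow, ← pow_mul] at h1
  -- The part (n + 1)g pays for the weight, as deg(a)^(-γ) ≤ D^((n+1)g). Since g ≤ n, the remaining
  -- exponent is at least n + 1, and 2^(n+1) > 2n.
  have hexp : (n + 1) ^ 2 = (n + 1) * g + (n + 1) * (n + 1 - g) := by
    rw [← mul_add, Nat.add_sub_cancel' (by omega), sq]
  have h2 : (D : ℝ) ^ ((n + 1) * (n + 1 - g)) ≤ 2 * weightedHeight γ a := by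
    refine le_of_mul_le_mul_left (a := (D : ℝ) ^ ((n + 1) * g)) ?_ (by positivity)
    rw [← pow_add, ← hexp]
    linarith
  have h3 : (2 : ℝ) ^ (n + 1) ≤ (D : ℝ) ^ ((n + 1) * (n + 1 - g)) :=
    (pow_le_pow_left₀ zero_le_two hD' _).trans
      (pow_le_pow_right₀ (by linarith) (Nat.le_mul_of_pos_right _ (by omega)))
  have h4 : (n : ℝ) < 2 ^ n := by exact_mod_cast Nat.lt_two_pow_self
  rw [pow_succ] at h3
  linarith

theorem proposition5p4
    (d p q : ℕ+ → ℕ)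
    (hd : StrictMono d) (hp : StrictMono p) (hq : StrictMono q)
    (hd_prime : ∀ i, (d i).Prime) (hp_prime : ∀ i, (p i).Prime) (hq_prime : ∀ i, (q i).Prime)
    (hdp : ∀ i : ℕ+, Real.exp ((d i : ℝ) ^ (1 + (i : ℕ) ^ 2)) ≤ (p i : ℝ))
    (hpq : ∀ i, p i < q i) (hqp : ∀ i, q i < p (i + 1))
    (α : ℕ+ → AlgebraicClosure ℚ)
    (hα : ∀ i, α i ^ d i = (p i : AlgebraicClosure ℚ) / (q i : AlgebraicClosure ℚ)) :
    ¬ FiniteDimensional ℚ (IntermediateField.adjoin ℚ (Set.range α)) ∧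
      northcottInterval (IntermediateField.adjoin ℚ (Set.range α) : Set (AlgebraicClosure ℚ)) =
        Set.univ := by
  have hrank (i : ℕ+) : finrank ℚ ℚ⟮α i⟯ = d i :=
    finrank_adjoin_radical (hp_prime i) (hq_prime i) (hpq i).ne (hd_prime i) (hα i)
  refine ⟨fun hfin ↦ ?_, Set.eq_univ_of_forall fun γ C hC ↦ ?_⟩
  · have hle (i : ℕ+) : d i ≤ finrank ℚ (adjoin ℚ (Set.range α)) := by
      rw [← hrank i]
      exact IntermediateField.finrank_le_of_le_right
        (adjoin_simple_le_iff.mpr (subset_adjoin ℚ _ ⟨i, rfl⟩))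
    have hmono : StrictMono fun n : ℕ ↦ d n.succPNat :=
      hd.comp fun m n h ↦ Nat.succPNat_lt_succPNat.mpr h
    have := hmono.le_apply (x := finrank ℚ (adjoin ℚ (Set.range α)) + 1)
    have := hle (finrank ℚ (adjoin ℚ (Set.range α)) + 1).succPNat
    omega
  · obtain ⟨g, hg⟩ := exists_nat_ge (-γ)
    obtain ⟨c, hc⟩ := exists_nat_ge C
    rw [northcottCount, Set.encard_lt_top_iff]
    refine (finite_weightedHeight_lt γ C (initialField α (max g c))).subset ?_
    rintro a ⟨ha, haC⟩
    refine ⟨?_, haC⟩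
    classical
    have hex := exists_mem_initialField ha
    have hmem := Nat.find_spec hex
    -- Take the first field of the tower containing a. If its index is n + 1 > max g c, then n ≥ g
    -- and n ≥ c ≥ C, and h_γ(a) ≥ n contradicts h_γ(a) < C.
    by_cases hN : Nat.find hex ≤ max g c
    · exact adjoin.mono ℚ _ _ (Set.image_mono fun j hj ↦ le_trans hj hN) hmem
    · obtain ⟨n, hn⟩ := Nat.exists_eq_add_one_of_ne_zero (show Nat.find hex ≠ 0 by omega)
      have hnot : a ∉ initialField α n := Nat.find_min hex (by omega)
      rw [hn] at hmem hN
      have hn1 : g ≤ n := (le_max_left g c).trans (by omega)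
      have hn2 : c ≤ n := (le_max_right g c).trans (by omega)
      have hbound := le_weightedHeight_of_pow_le hg hn1 (hd_prime n.succPNat).two_le
        ((algDeg_le_finrank hmem).trans (finrank_initialField_succ_le hd.monotone hrank n))
        (pow_le_two_mul_absLogHeight₁ hp hd_prime hp_prime hq_prime hdp hpq hqp hα n hmem hnot)
      have : (c : ℝ) ≤ n := Nat.cast_le.mpr hn2
      linarith
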